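/- Let $E$ be a locally compact separable metric space with its Borel $\sigma$-field, $U$ a nonempty compact metric space, and $P^a(x,\cdot)$, $(x,a)\in E\times U$, a Markov transition kernel from $E\times U$ to $E$. Let $c:E\times U\to\mathbb R$ be bounded and continuous, and let $\phi:\mathbb N\to[0,1]$ be nonincreasing with $\phi(0)=1$, $\phi(n+k)\ge\phi(n)\phi(k)$ for all $n,k$, and $\sum_{i\ge 0}\phi(i)=\infty$. A control $V=(a_0,a_1,\dots)$ is a $U$-valued sequence adapted to a filtration $(F_n)$, where the controlled process $(X_n)$ is adapted, $X_0=x$, and $\mathbb P(X_{n+1}\in B\mid F_n)=P^{a_n}(X_n,B)$; a stationary Markov control $u:E\to U$ means $a_n=u(X_n)$. For $\gamma\ne 0$, $k\in\mathbb N$ and $x\in E$ put $$J_x(V)=\liminf_{n\to\infty}\tfrac1n\,\mathbb E_x^V\Big[\sum_{i=0}^{n-1}c(X_i,a_i)\Big],\qquad I_x^\gamma(V)=\liminf_{n\to\infty}\tfrac1{n\gamma}\ln\mathbb E_x^V\Big[\exp\Big\{\gamma\sum_{i=0}^{n-1}c(X_i,a_i)\Big\}\Big],$$ $$I_{k,x}^{\gamma,g}(V)=\liminf_{n\to\infty}\Big(\gamma\sum_{i=k}^{n+k-1}\phi(i)\Big)^{-1}\ln\mathbb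 E_{x}^V\Big[\exp\Big\{\gamma\sum_{i=k}^{n+k-1}\phi(i)c(X_{i-k},a_{i-k})\Big\}\Big],$$ and $v(x)=\sup_VJ_x(V)$, $v^{\gamma,g}(k,x)=\sup_VI_{k,x}^{\gamma,g}(V)$. Assume (A.3): there are a probability measure $\eta$ on $E$, a constant $M>0$ and a function $p$ such that $P^a(x,B)=\int_Bp(x,a,y)\,\eta(dy)$ for all Borel $B$, the map $(x,a)\mapsto p(x,a,y)$ is continuous for every $y\in E$, and $\frac1M\le p(x,a,y)\le M$ for all $x,y\in E$, $a\in U$. Then: (1) There is a constant $\lambda\in\mathbb R$ for which the Bellman equation $w(x)=\sup_{a\in U}\big[c(x,a)-\lambda+\int_Ew(y)P^a(x,dy)\big]$ has a bounded continuous solution $w$, $v(x)=\lambda$ for every $x\in E$, and $\lim_{\gamma\to0^-}v^{\gamma,g}(k,x)=\lambda$ for all $k\in\mathbb N$, $x\in E$. (2) Let $\varepsilon\ge0$ and let $u:E\to U$ be a continuous stationary Markov control that is $\varepsilon$-optimal for the average reward, i.e. $J_x(u)\ge v(x)-\varepsilon$ for all $x\in E$. Then for every $\delta>0$ there is $\gamma_0<0$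 such that $I_{k,x}^{\gamma,g}(u)\ge v^{\gamma,g}(k,x)-(\varepsilon+\delta)$ for all $\gamma\in(\gamma_0,0)$, $k\in\mathbb N$ and $x\in E$. (3) For every continuous stationary Markov control $u:E\to U$ there is a constant $\lambda^u\in\mathbb R$ for which the Poisson equation $w(x)=c(x,u(x))-\lambda^u+\int_Ew(y)P^{u(x)}(x,dy)$ has a bounded Borel solution $w$, $J_x(u)=\lambda^u$ for every $x\in E$, and for all $k\in\mathbb N$, $x\in E$ $$\lim_{\gamma\to0^+}I_{k,x}^{\gamma,g}(u)=\lim_{\gamma\to0^+}I_x^\gamma(u)=\lambda^u.$$ -/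

import Mathlib

open MeasureTheory ProbabilityTheory Filter Topology BoundedContinuousFunction

universe u v

noncomputable section

/-- A generalized discount factor: `φ : ℕ → [0,1]` nonincreasing, `φ 0 = 1`,
`φ (n + k) ≥ φ n * φ k`, and `∑ φ i = ∞`. -/
structure IsDiscountFactor (φ : ℕ → ℝ) : Prop where
  nonneg : ∀ n, 0 ≤ φ n
  le_one : ∀ n, φ n ≤ 1
  zero : φ 0 = 1
  antitone : Antitone φ
  supermul : ∀ n k, φ n * φ k ≤ φ (n + k)
  sum_eq_top : Tendsto (fun n : ℕ => ∑ i ∈ Finset.range n, φ i) atTop atTop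

section Control

variable {E : Type u} {U : Type v} [MeasurableSpace E] [MeasurableSpace U]

/-- A Markov process controlled with the transition kernel `P (x, a) = P^a(x, ·)` and started
from `x`: a filtered probability space, an adapted state process `X` and an adapted control
sequence `V = (a 0, a 1, …)`, such that the conditional law of `X (n + 1)` given `ℱ n` is
`P^{a n}(X n, ·)`. The universe of `Ω` is large enough to contain the canonical space
`ℕ → E × U` of state-action trajectories, hence the law of every such process. -/
structure ControlledProcess (P : Kernel (E × U) E) (x : E) where
  Ω : Type (max u v)
  mΩ : MeasurableSpace Ω
  μ : Measure Ω
  isProb : IsProbabilityMeasure μ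
  ℱ : Filtration ℕ mΩ
  X : ℕ → Ω → E
  a : ℕ → Ω → U
  state_adapted : ∀ n, Measurable[ℱ n] (X n)
  control_adapted : ∀ n, Measurable[ℱ n] (a n)
  start : ∀ᵐ ω ∂μ, X 0 ω = x
  transition : ∀ (n : ℕ) (A : Set Ω), MeasurableSet[ℱ n] A → ∀ B : Set E, MeasurableSet B →
    μ (A ∩ X (n + 1) ⁻¹' B) = ∫⁻ ω in A, P (X n ω, a n ω) B ∂μ

attribute [instance] ControlledProcess.mΩ ControlledProcess.isProb

/-- One step of the state-action chain under the stationary control `u`: from a trajectory up to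
time `n` with last state `x`, draw `y` from `P^{u x}(x, ·)` and move to `(y, u y)`. -/
def stationaryStep (P : Kernel (E × U) E) (f : E → U) (hf : Measurable f) (n : ℕ) :
    Kernel (Π _ : Finset.Iic n, E × U) (E × U) :=
  ((P.comap (fun x : E => (x, f x)) (measurable_id.prodMk hf)).map (fun y => (y, f y))).comap
    (fun h : Π _ : Finset.Iic n, E × U => (h ⟨n, Finset.mem_Iic.2 le_rfl⟩).1)
    (measurable_fst.comp (measurable_pi_apply _))

instance (P : Kernel (E × U) E) [IsMarkovKernel P] (f : E → U) (hf : Measurable f) (n : ℕ) :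
    IsMarkovKernel (stationaryStep P f hf n) := by
  unfold stationaryStep
  have : IsMarkovKernel ((P.comap (fun x : E => (x, f x)) (measurable_id.prodMk hf)).map
    (fun y => (y, f y))) := Kernel.IsMarkovKernel.map _ (measurable_id.prodMk hf)
  infer_instance

/-- The law of the state-action chain under the stationary control `f`, started from `x`. -/
def stationaryLaw (P : Kernel (E × U) E) [IsMarkovKernel P] (f : E → U) (hf : Measurable f)
    (x : E) : Measure (ℕ → E × U) :=
  Kernel.trajMeasure (X := fun _ => E × U) (Measure.dirac (x, f x)) (stationaryStep P f hf)

instance (P : Kernel (E × U) E) [IsMarkovKernel P] (f : E → U) (hf : Measurable f)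
    (x : E) : IsProbabilityMeasure (stationaryLaw P f hf x) := by
  unfold stationaryLaw
  infer_instance

theorem stationaryLaw_transition (P : Kernel (E × U) E) [IsMarkovKernel P] (f : E → U)
    (hf : Measurable f) (x : E) (n : ℕ) (A : Set (ℕ → E × U))
    (hA : MeasurableSet[Filtration.piLE (X := fun _ : ℕ => E × U) n] A)
    (B : Set E) (hB : MeasurableSet B) :
    stationaryLaw P f hf x (A ∩ (fun ω : ℕ → E × U => (ω (n + 1)).1) ⁻¹' B) =
      ∫⁻ ω in A, P ((ω n).1, f (ω n).1) B ∂stationaryLaw P f hf x := by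
  rw [Filtration.piLE_eq_comap_frestrictLe] at hA
  obtain ⟨S, hS, rfl⟩ := hA
  have key := Kernel.map_frestrictLe_trajMeasure_compProd_eq_map_trajMeasure
    (X := fun _ : ℕ => E × U) (μ₀ := Measure.dirac (x, f x)) (κ := stationaryStep P f hf) (a := n)
  have hm : Measurable (Preorder.frestrictLe (π := fun _ : ℕ => E × U) n) := by fun_prop
  have hB' : MeasurableSet (Prod.fst ⁻¹' B : Set (E × U)) := measurable_fst hB
  have h2 := congrArg (fun ν => ν (S ×ˢ (Prod.fst ⁻¹' B : Set (E × U)))) key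
  beta_reduce at h2
  rw [Measure.compProd_apply_prod hS hB', setLIntegral_map hS (Kernel.measurable_coe _ hB') hm,
    Measure.map_apply (hm.prodMk (measurable_pi_apply _)) (hS.prod hB')] at h2
  refine Eq.trans h2.symm ?_
  refine lintegral_congr fun ω => ?_
  have hg : Measurable fun y : E => (y, f y) := measurable_id.prodMk hf
  unfold stationaryStep
  rw [Kernel.comap_apply]
  rw [Kernel.map_apply' _ hg _ hB']
  rfl

theorem stationaryLaw_start [MeasurableSingletonClass E] (P : Kernel (E × U) E) [IsMarkovKernel P] (f : E → U)
    (hf : Measurable f) (x : E) : ∀ᵐ ω ∂stationaryLaw P f hf x, (ω 0).1 = x := by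
  have hm : Measurable (Preorder.frestrictLe (π := fun _ : ℕ => E × U) 0) := by fun_prop
  let e : (Π _ : Finset.Iic 0, E × U) → E :=
    fun h => (h ⟨0, Finset.mem_Iic.2 le_rfl⟩).1
  have he : Measurable e := measurable_fst.comp (measurable_pi_apply _)
  have h0 : (stationaryLaw P f hf x).map (Preorder.frestrictLe (π := fun _ : ℕ => E × U) 0) =
      (Measure.dirac (x, f x)).map
        (MeasurableEquiv.piUnique (fun _ : Finset.Iic 0 => E × U)).symm := by
    unfold stationaryLaw Kernel.trajMeasure
    rw [Measure.map_comp _ _ hm, Kernel.traj_map_frestrictLe, Kernel.partialTraj_self]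
    exact Measure.id_comp
  have hS : MeasurableSet (e ⁻¹' {x}ᶜ) := he (measurableSet_singleton x).compl
  have h1 := congrArg (fun ν => ν (e ⁻¹' {x}ᶜ)) h0
  beta_reduce at h1
  rw [Measure.map_apply hm hS, Measure.map_apply (MeasurableEquiv.measurable _) hS,
    Measure.dirac_apply' _ (MeasurableEquiv.measurable _ hS)] at h1
  refine ae_iff.2 (Eq.trans h1 ?_)
  refine Set.indicator_of_notMem ?_ _
  intro h
  exact h rfl

theorem measurable_eval_piLE (n : ℕ) :
    Measurable[Filtration.piLE (X := fun _ : ℕ => E × U) n] fun ω : ℕ → E × U => ω n := by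
  rw [Filtration.piLE_eq_comap_frestrictLe]
  exact (measurable_pi_apply (⟨n, Finset.mem_Iic.2 le_rfl⟩ : Finset.Iic n)).comp
    (comap_measurable (Preorder.frestrictLe (π := fun _ : ℕ => E × U) n))

/-- The controlled process obtained from the stationary Markov control `a n = f (X n)`. -/
def stationary [MeasurableSingletonClass E] (P : Kernel (E × U) E) [IsMarkovKernel P] (f : E → U) (hf : Measurable f)
    (x : E) : ControlledProcess P x where
  Ω := ℕ → E × U
  mΩ := inferInstance
  μ := stationaryLaw P f hf x
  isProb := inferInstance
  ℱ := Filtration.piLE (X := fun _ : ℕ => E × U)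
  X n ω := (ω n).1
  a n ω := f (ω n).1
  state_adapted n := measurable_fst.comp (measurable_eval_piLE n)
  control_adapted n := hf.comp (measurable_fst.comp (measurable_eval_piLE n))
  start := stationaryLaw_start P f hf x
  transition := stationaryLaw_transition P f hf x

variable [TopologicalSpace E] [TopologicalSpace U] {P : Kernel (E × U) E} {x : E}

/-- The average reward per unit time functional `J_x(V)`. -/
def averageReward (c : E × U →ᵇ ℝ) (V : ControlledProcess P x) : EReal :=
  liminf (fun n : ℕ => (((1 / (n : ℝ)) *
    ∫ ω, ∑ i ∈ Finset.range n, c (V.X i ω, V.a i ω) ∂V.μ : ℝ) : EReal)) atTop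

/-- The risk-sensitive functional `I_x^γ(V)` without discounting. -/
def riskReward (c : E × U →ᵇ ℝ) (γ : ℝ) (V : ControlledProcess P x) : EReal :=
  liminf (fun n : ℕ => (((1 / ((n : ℝ) * γ)) *
    Real.log (∫ ω, Real.exp (γ * ∑ i ∈ Finset.range n, c (V.X i ω, V.a i ω)) ∂V.μ) : ℝ) :
      EReal)) atTop

/-- The risk-sensitive functional `I_{k,x}^{γ,g}(V)` with general discounting; the process is
started at time `k`, and the sums over `k ≤ i ≤ n + k - 1` are written with `i = k + j`. -/
def discountedRiskReward (c : E × U →ᵇ ℝ) (φ : ℕ → ℝ) (γ : ℝ) (k : ℕ)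
    (V : ControlledProcess P x) : EReal :=
  liminf (fun n : ℕ => (((γ * ∑ j ∈ Finset.range n, φ (k + j))⁻¹ *
    Real.log (∫ ω, Real.exp
      (γ * ∑ j ∈ Finset.range n, φ (k + j) * c (V.X j ω, V.a j ω)) ∂V.μ) : ℝ) : EReal)) atTop

/-- The value `v(x) = sup_V J_x(V)` of the average reward problem. -/
def averageValue (P : Kernel (E × U) E) (c : E × U →ᵇ ℝ) (x : E) : EReal :=
  ⨆ V : ControlledProcess P x, averageReward c V

/-- The value `v^{γ,g}(k,x) = sup_V I_{k,x}^{γ,g}(V)` of the discounted risk-sensitive problem. -/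
def discountedRiskValue (P : Kernel (E × U) E) (c : E × U →ᵇ ℝ) (φ : ℕ → ℝ) (γ : ℝ) (k : ℕ)
    (x : E) : EReal :=
  ⨆ V : ControlledProcess P x, discountedRiskReward c φ γ k V

/-- `ℓ` is a constant for which the average reward Bellman equation
`w x = sup_a [c (x, a) - ℓ + ∫ w dP^a(x, ·)]` has a bounded continuous solution `w`. -/
def IsBellmanConstant (P : Kernel (E × U) E) (c : E × U →ᵇ ℝ) (ℓ : ℝ) : Prop :=
  ∃ w : E →ᵇ ℝ, ∀ x : E,
    IsLUB (Set.range fun a : U => c (x, a) - ℓ + ∫ y, w y ∂P (x, a)) (w x)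

/-- `ℓ` is a constant for which the Poisson equation of the stationary control `f`,
`w x = c (x, f x) - ℓ + ∫ w dP^{f x}(x, ·)`, has a bounded Borel solution `w`. -/
def IsPoissonConstant (P : Kernel (E × U) E) (c : E × U →ᵇ ℝ) (f : E → U) (ℓ : ℝ) : Prop :=
  ∃ w : E → ℝ, Measurable w ∧ (∃ K : ℝ, ∀ x, |w x| ≤ K) ∧
    ∀ x : E, w x = c (x, f x) - ℓ + ∫ y, w y ∂P (x, f x)

/-- The transition probabilities have densities `p(x, a, ·)` with respect to a common probability
measure `η`, continuous in `(x, a)` and bounded between `1 / M` and `M`. -/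
def HasBoundedDensity (P : Kernel (E × U) E) : Prop :=
  ∃ (η : Measure E) (p : E → U → E → ℝ) (M : ℝ), IsProbabilityMeasure η ∧ 0 < M ∧
    (∀ x a, Measurable (p x a)) ∧
    (∀ y, Continuous fun z : E × U => p z.1 z.2 y) ∧
    (∀ x a y, 1 / M ≤ p x a y ∧ p x a y ≤ M) ∧
    ∀ x a, ∀ B : Set E, MeasurableSet B → P (x, a) B = ∫⁻ y in B, ENNReal.ofReal (p x a y) ∂η

end Control

end

/-! Let `w` be bounded by `K`, write `Pw` for its integral against the transition kernel, and
suppose `c + Pw - w` stays on one side of `ℓ` along a process. With nonincreasing weights `ψ` in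
`[0,1]`, the reward `∑ ψ j * c` splits into `∑ ψ j * (c + Pw - w)`, a sum of weighted differences `w
(X j) - w (X (j+1))`, and a martingale. Abel summation bounds the second part by `2K`, whatever the
number of terms. The martingale has mean zero and, by a conditional Hoeffding bound, its exponential
moment at parameter `γ` is at most `exp (K²/2 * γ² * ∑ ψ j)`. After division by `γ * ∑ ψ j`, whose
modulus tends to infinity, only `ℓ` and an error `K²/2 * γ` remain, uniformly in the process, the
starting time and the state. In the other direction Jensen's inequality replaces Hoeffding and
leaves no error.

Such a `w` exists because the lower density bound gives `P z ≥ β η`. The operator `w ↦ sup_a [c + Pw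
- β ∫ w dη]` is a `(1-β)`-contraction in the sup norm, and its fixed point solves the Bellman
equation with `ℓ = β ∫ w dη`. A one-point control set yields the Poisson equation. Measurable
selectors that lose at most `e` in the Bellman supremum show that `ℓ` is the value. -/

open scoped ENNReal

/-! ### Elementary estimates: Abel summation and Hoeffding's lemma. -/

/-- Summation by parts for weights that decrease from a value at most one. -/
theorem abs_sum_mul_sub_succ_le {ψ w : ℕ → ℝ} {K : ℝ} (hanti : Antitone ψ) (h0 : ∀ n, 0 ≤ ψ n)
    (h1 : ∀ n, ψ n ≤ 1) (hw : ∀ n, |w n| ≤ K) (n : ℕ) :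
    |∑ j ∈ Finset.range n, ψ j * (w j - w (j + 1))| ≤ 2 * K := by
  have hK : 0 ≤ K := (abs_nonneg _).trans (hw 0)
  -- The boundary term `ψ n * w n` is carried along so that each induction step changes the sum by
  -- `(ψ n - ψ (n+1)) * w (n+1)`, and these bounds telescope.
  have key : ∀ n, |∑ j ∈ Finset.range n, ψ j * (w j - w (j + 1)) + ψ n * w n| ≤
      K * (2 * ψ 0 - ψ n) := by
    intro n
    induction n with
    | zero =>
      simp only [Finset.range_zero, Finset.sum_empty, zero_add, abs_mul, abs_of_nonneg (h0 0)]
      nlinarith [hw 0, h0 0]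
    | succ n ih =>
      have hd : 0 ≤ ψ n - ψ (n + 1) := sub_nonneg.2 (hanti n.le_succ)
      have h2 : |(ψ n - ψ (n + 1)) * w (n + 1)| ≤ (ψ n - ψ (n + 1)) * K := by
        rw [abs_mul, abs_of_nonneg hd]
        exact mul_le_mul_of_nonneg_left (hw _) hd
      have e : ∑ j ∈ Finset.range (n + 1), ψ j * (w j - w (j + 1)) + ψ (n + 1) * w (n + 1) =
          (∑ j ∈ Finset.range n, ψ j * (w j - w (j + 1)) + ψ n * w n) -
            (ψ n - ψ (n + 1)) * w (n + 1) := by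
        rw [Finset.sum_range_succ]; ring
      rw [e]
      refine (abs_sub _ _).trans ?_
      linarith
  have h3 : |ψ n * w n| ≤ ψ n * K := by
    rw [abs_mul, abs_of_nonneg (h0 n)]
    exact mul_le_mul_of_nonneg_left (hw n) (h0 n)
  have h4 := key n
  rw [abs_le] at h3 h4 ⊢
  have h5 : K * ψ 0 ≤ K * 1 := mul_le_mul_of_nonneg_left (h1 0) hK
  constructor <;> nlinarith

/-- Hoeffding's bound for the exponential moments of a bounded function. -/
theorem lintegral_ofReal_exp_sub_integral_le {E : Type*} [MeasurableSpace E] (ν : Measure E)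
    [IsProbabilityMeasure ν] {w : E → ℝ} {K : ℝ} (hw : Measurable w) (hK : ∀ x, |w x| ≤ K)
    (t : ℝ) :
    ∫⁻ y, ENNReal.ofReal (Real.exp (t * (w y - ∫ z, w z ∂ν))) ∂ν ≤
      ENNReal.ofReal (Real.exp (K ^ 2 * t ^ 2 / 2)) := by
  obtain ⟨x⟩ : Nonempty E := nonempty_of_isProbabilityMeasure ν
  have hK0 : 0 ≤ K := (abs_nonneg _).trans (hK x)
  have h := hasSubgaussianMGF_of_mem_Icc (μ := ν) (a := -K) (b := K) hw.aemeasurable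
    (ae_of_all _ fun y => abs_le.1 (hK y))
  rw [← ofReal_integral_eq_lintegral_ofReal (h.integrable_exp_mul t)
    (ae_of_all _ fun _ => (Real.exp_pos _).le)]
  refine ENNReal.ofReal_le_ofReal ((h.mgf_le t).trans_eq ?_)
  congr 3
  -- An interval of length `2K` has sub-Gaussian variance proxy `(2K/2)² = K²`.
  have e : K - -K = 2 * K := by ring
  simp only [NNReal.coe_pow, NNReal.coe_div, coe_nnnorm, e, Real.norm_eq_abs, NNReal.coe_ofNat]
  rw [div_pow, sq_abs]
  ring

/-! ### The one-step Markov property. -/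

namespace ControlledProcess

variable {E : Type u} {U : Type v} [MeasurableSpace E] [MeasurableSpace U]
  {P : Kernel (E × U) E} {x : E} (V : ControlledProcess P x)

theorem measurable_state (n : ℕ) : Measurable (V.X n) := (V.state_adapted n).mono (V.ℱ.le n) le_rfl

theorem measurable_control (n : ℕ) : Measurable (V.a n) :=
  (V.control_adapted n).mono (V.ℱ.le n) le_rfl

theorem measurable_pair (n : ℕ) : Measurable fun ω => (V.X n ω, V.a n ω) :=
  (V.measurable_state n).prodMk (V.measurable_control n)

theorem map_restrict_state_succ (n : ℕ) {A : Set V.Ω} (hA : MeasurableSet[V.ℱ n] A) :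
    (V.μ.restrict A).map (V.X (n + 1)) =
      ((V.μ.restrict A).map fun ω => (V.X n ω, V.a n ω)).bind P := by
  ext B hB
  rw [Measure.bind_apply hB P.measurable.aemeasurable,
    lintegral_map (P.measurable_coe hB) (V.measurable_pair n),
    Measure.map_apply (V.measurable_state _) hB,
    Measure.restrict_apply (V.measurable_state _ hB), Set.inter_comm]
  exact V.transition n A hA B hB

theorem setLIntegral_comp_state_succ (n : ℕ) {A : Set V.Ω} (hA : MeasurableSet[V.ℱ n] A)
    {g : E → ℝ≥0∞} (hg : Measurable g) :
    ∫⁻ ω in A, g (V.X (n + 1) ω) ∂V.μ =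
      ∫⁻ ω in A, ∫⁻ y, g y ∂P (V.X n ω, V.a n ω) ∂V.μ := by
  rw [← lintegral_map hg (V.measurable_state _), V.map_restrict_state_succ n hA,
    Measure.lintegral_bind P.measurable.aemeasurable hg.aemeasurable,
    lintegral_map hg.lintegral_kernel (V.measurable_pair n)]

/-- This replaces conditional expectation: the measures with densities `g (X (n+1))` and its
one-step average agree on the sets of `ℱ n`, hence integrate every `ℱ n`-measurable weight equally.
-/
theorem lintegral_mul_comp_state_succ (n : ℕ) {h : V.Ω → ℝ≥0∞} (hh : Measurable[V.ℱ n] h)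
    {g : E → ℝ≥0∞} (hg : Measurable g) :
    ∫⁻ ω, h ω * g (V.X (n + 1) ω) ∂V.μ =
      ∫⁻ ω, h ω * ∫⁻ y, g y ∂P (V.X n ω, V.a n ω) ∂V.μ := by
  have hG : Measurable fun ω => g (V.X (n + 1) ω) := hg.comp (V.measurable_state _)
  have hG' : Measurable fun ω => ∫⁻ y, g y ∂P (V.X n ω, V.a n ω) :=
    hg.lintegral_kernel.comp (V.measurable_pair n)
  have key : (V.μ.withDensity fun ω => g (V.X (n + 1) ω)).trim (V.ℱ.le n) =
      (V.μ.withDensity fun ω => ∫⁻ y, g y ∂P (V.X n ω, V.a n ω)).trim (V.ℱ.le n) := by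
    refine @Measure.ext _ (V.ℱ n) _ _ fun A hA => ?_
    rw [trim_measurableSet_eq _ hA, trim_measurableSet_eq _ hA,
      withDensity_apply _ (V.ℱ.le n _ hA), withDensity_apply _ (V.ℱ.le n _ hA)]
    exact V.setLIntegral_comp_state_succ n hA hg
  have h2 := congrArg (fun ν => ∫⁻ ω, h ω ∂ν) key
  beta_reduce at h2
  have hh' := hh.mono (V.ℱ.le n) le_rfl
  rw [lintegral_trim _ hh, lintegral_trim _ hh, lintegral_withDensity_eq_lintegral_mul _ hG hh',
    lintegral_withDensity_eq_lintegral_mul _ hG' hh'] at h2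
  simpa only [Pi.mul_apply, mul_comm] using h2

theorem integral_comp_state_succ [IsMarkovKernel P] (n : ℕ) {w : E → ℝ} (hw : Measurable w) {K : ℝ}
    (hK : ∀ x, |w x| ≤ K) :
    ∫ ω, w (V.X (n + 1) ω) ∂V.μ = ∫ ω, ∫ y, w y ∂P (V.X n ω, V.a n ω) ∂V.μ := by
  have h := V.map_restrict_state_succ n (A := Set.univ) MeasurableSet.univ
  rw [Measure.restrict_univ] at h
  have := Measure.isProbabilityMeasure_map (μ := V.μ) (V.measurable_pair n).aemeasurable
  have hint : Integrable w ((P ∘ₖ Kernel.const Unit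
      (V.μ.map fun ω => (V.X n ω, V.a n ω))) ()) :=
    Integrable.of_bound hw.aestronglyMeasurable K (ae_of_all _ hK)
  have h2 := ProbabilityTheory.Kernel.integral_comp hint
  rw [Kernel.comp_apply, Kernel.const_apply, integral_map (V.measurable_pair n).aemeasurable
    hw.stronglyMeasurable.integral_kernel.aestronglyMeasurable] at h2
  rw [← integral_map (V.measurable_state _).aemeasurable hw.aestronglyMeasurable, h, h2]

end ControlledProcess

/-! ### The martingale part and finite-horizon bounds. -/

namespace ControlledProcess

variable {E : Type u} {U : Type v} [MeasurableSpace E] [MeasurableSpace U]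
  {P : Kernel (E × U) E} {x : E} (V : ControlledProcess P x)

/-- Induction on `n`: everything except `w (X (n+1))` is `ℱ n`-measurable, so the Markov property
averages the last factor under `P (X n, a n)`, where Hoeffding's lemma bounds it by a constant. -/
theorem lintegral_exp_sum_martingale_le [IsMarkovKernel P] {w : E → ℝ} (hw : Measurable w) {K : ℝ}
    (hK : ∀ x, |w x| ≤ K) (θ : ℕ → ℝ) (n : ℕ) :
    ∫⁻ ω, ENNReal.ofReal (Real.exp (∑ j ∈ Finset.range n,
      θ j * (w (V.X (j + 1) ω) - ∫ y, w y ∂P (V.X j ω, V.a j ω)))) ∂V.μ ≤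
      ENNReal.ofReal (Real.exp (K ^ 2 / 2 * ∑ j ∈ Finset.range n, θ j ^ 2)) := by
  have hI : Measurable fun z : E × U => ∫ y, w y ∂P z :=
    hw.stronglyMeasurable.integral_kernel.measurable
  induction n with
  | zero => simp
  | succ n ih =>
    let S : V.Ω → ℝ := fun ω => ∑ j ∈ Finset.range n,
      θ j * (w (V.X (j + 1) ω) - ∫ y, w y ∂P (V.X j ω, V.a j ω))
    let R : V.Ω → ℝ := fun ω => ∫ y, w y ∂P (V.X n ω, V.a n ω)
    have hR : Measurable[V.ℱ n] R := hI.comp ((V.state_adapted n).prodMk (V.control_adapted n))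
    have hS : Measurable[V.ℱ n] S := by
      refine Finset.measurable_fun_sum _ fun j hj => ?_
      have hj : j < n := Finset.mem_range.1 hj
      have h1 : Measurable[V.ℱ n] fun ω => w (V.X (j + 1) ω) :=
        hw.comp ((V.state_adapted (j + 1)).mono (V.ℱ.mono hj) le_rfl)
      have h2 : Measurable[V.ℱ n] fun ω => ∫ y, w y ∂P (V.X j ω, V.a j ω) :=
        hI.comp (((V.state_adapted j).prodMk (V.control_adapted j)).mono (V.ℱ.mono hj.le) le_rfl)
      exact (h1.sub h2).const_mul _
    have hh : Measurable[V.ℱ n] fun ω => ENNReal.ofReal (Real.exp (S ω - θ n * R ω)) :=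
      ENNReal.measurable_ofReal.comp (Real.measurable_exp.comp (hS.sub (hR.const_mul _)))
    have hg : Measurable fun y => ENNReal.ofReal (Real.exp (θ n * w y)) :=
      ENNReal.measurable_ofReal.comp (Real.measurable_exp.comp (hw.const_mul _))
    have h1 := V.lintegral_mul_comp_state_succ n hh hg
    calc _ = ∫⁻ ω, ENNReal.ofReal (Real.exp (S ω - θ n * R ω)) *
          ENNReal.ofReal (Real.exp (θ n * w (V.X (n + 1) ω))) ∂V.μ := by
          refine lintegral_congr fun ω => ?_
          rw [← ENNReal.ofReal_mul (Real.exp_pos _).le, ← Real.exp_add, Finset.sum_range_succ]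
          congr 2
          simp only [S, R]
          ring
      _ = _ := h1
      _ ≤ ∫⁻ ω, ENNReal.ofReal (Real.exp (S ω)) *
          ENNReal.ofReal (Real.exp (K ^ 2 * θ n ^ 2 / 2)) ∂V.μ := by
          refine lintegral_mono fun ω => ?_
          have h2 := lintegral_ofReal_exp_sub_integral_le (P (V.X n ω, V.a n ω)) hw hK (θ n)
          refine le_trans (le_of_eq ?_) (mul_le_mul_right h2 _)
          beta_reduce
          rw [← lintegral_const_mul' _ _ ENNReal.ofReal_ne_top,
            ← lintegral_const_mul' _ _ ENNReal.ofReal_ne_top]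
          refine lintegral_congr fun y => ?_
          rw [← ENNReal.ofReal_mul (Real.exp_pos _).le, ← ENNReal.ofReal_mul (Real.exp_pos _).le,
            ← Real.exp_add, ← Real.exp_add]
          congr 2
          simp only [R]
          ring
      _ ≤ _ := by
          rw [lintegral_mul_const' _ _ ENNReal.ofReal_ne_top]
          refine (mul_le_mul_left ih _).trans_eq ?_
          rw [← ENNReal.ofReal_mul (Real.exp_pos _).le, ← Real.exp_add, Finset.sum_range_succ]
          congr 2
          ring

theorem integral_sum_martingale [IsMarkovKernel P] {w : E → ℝ} (hw : Measurable w) {K : ℝ}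
    (hK : ∀ x, |w x| ≤ K) (θ : ℕ → ℝ) (n : ℕ) :
    Integrable (fun ω => ∑ j ∈ Finset.range n,
      θ j * (w (V.X (j + 1) ω) - ∫ y, w y ∂P (V.X j ω, V.a j ω))) V.μ ∧
    ∫ ω, ∑ j ∈ Finset.range n,
      θ j * (w (V.X (j + 1) ω) - ∫ y, w y ∂P (V.X j ω, V.a j ω)) ∂V.μ = 0 := by
  have hI : Measurable fun z : E × U => ∫ y, w y ∂P z :=
    hw.stronglyMeasurable.integral_kernel.measurable
  have h1 : ∀ j, Integrable (fun ω => w (V.X (j + 1) ω)) V.μ := fun j =>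
    Integrable.of_bound (hw.comp (V.measurable_state _)).aestronglyMeasurable K
      (ae_of_all _ fun ω => hK _)
  have h2 : ∀ j, Integrable (fun ω => ∫ y, w y ∂P (V.X j ω, V.a j ω)) V.μ := fun j =>
    Integrable.of_bound (hI.comp (V.measurable_pair _)).aestronglyMeasurable K
      (ae_of_all _ fun ω => by
        simpa using norm_integral_le_of_norm_le_const (μ := P (V.X j ω, V.a j ω))
          (f := w) (C := K)
          (ae_of_all _ hK))
  have h3 : ∀ j, Integrable (fun ω =>
      θ j * (w (V.X (j + 1) ω) - ∫ y, w y ∂P (V.X j ω, V.a j ω))) V.μ := fun j =>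
    ((h1 j).sub (h2 j)).const_mul _
  refine ⟨integrable_finsetSum _ fun j _ => h3 j, ?_⟩
  rw [integral_finsetSum _ fun j _ => h3 j]
  refine Finset.sum_eq_zero fun j _ => ?_
  rw [integral_const_mul, integral_sub (h1 j) (h2 j), V.integral_comp_state_succ j hw hK, sub_self,
    mul_zero]

variable [TopologicalSpace E] [TopologicalSpace U] (c : E × U →ᵇ ℝ)

theorem abs_sum_reward_le (ψ : ℕ → ℝ) (n : ℕ) (ω : V.Ω) :
    |∑ j ∈ Finset.range n, ψ j * c (V.X j ω, V.a j ω)| ≤ (∑ j ∈ Finset.range n, |ψ j|) * ‖c‖ := by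
  rw [Finset.sum_mul]
  refine (Finset.abs_sum_le_sum_abs _ _).trans (Finset.sum_le_sum fun j _ => ?_)
  rw [abs_mul]
  exact mul_le_mul_of_nonneg_left (c.norm_coe_le_norm _) (abs_nonneg _)

/-- If `γ * (c + ∫ w dP - w) ≤ γ * ℓ` along the process, the weighted reward is bounded, up to a
constant, by its martingale part. -/
theorem mul_sum_reward_le {ψ : ℕ → ℝ} (hanti : Antitone ψ) (h0 : ∀ n, 0 ≤ ψ n)
    (h1 : ∀ n, ψ n ≤ 1) {w : E → ℝ} {K : ℝ} (hK : ∀ x, |w x| ≤ K) {γ ℓ : ℝ} {ω : V.Ω}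
    (h : ∀ n, γ * (c (V.X n ω, V.a n ω) + ∫ y, w y ∂P (V.X n ω, V.a n ω) - w (V.X n ω)) ≤ γ * ℓ)
    (n : ℕ) :
    γ * ∑ j ∈ Finset.range n, ψ j * c (V.X j ω, V.a j ω) ≤
      γ * ℓ * (∑ j ∈ Finset.range n, ψ j) + 2 * K * |γ| + ∑ j ∈ Finset.range n,
        γ * ψ j * (w (V.X (j + 1) ω) - ∫ y, w y ∂P (V.X j ω, V.a j ω)) := by
  have hab := abs_sum_mul_sub_succ_le hanti h0 h1 (fun j => hK (V.X j ω)) n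
  have h2 : γ * ∑ j ∈ Finset.range n, ψ j * (w (V.X j ω) - w (V.X (j + 1) ω)) ≤ 2 * K * |γ| := by
    refine (le_abs_self _).trans ?_
    rw [abs_mul, mul_comm]
    exact mul_le_mul_of_nonneg_right hab (abs_nonneg _)
  have h3 : ∑ j ∈ Finset.range n, ψ j *
      (γ * (c (V.X j ω, V.a j ω) + ∫ y, w y ∂P (V.X j ω, V.a j ω) - w (V.X j ω))) ≤
      ∑ j ∈ Finset.range n, ψ j * (γ * ℓ) :=
    Finset.sum_le_sum fun j _ => mul_le_mul_of_nonneg_left (h j) (h0 j)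
  rw [← Finset.sum_mul, mul_comm (∑ j ∈ Finset.range n, ψ j)] at h3
  -- Adding and subtracting `w (X j)`, `w (X (j+1))` and `∫ w dP` gives the three parts: drift,
  -- telescoping, martingale.
  have e : γ * ∑ j ∈ Finset.range n, ψ j * c (V.X j ω, V.a j ω) =
      ∑ j ∈ Finset.range n, ψ j *
        (γ * (c (V.X j ω, V.a j ω) + ∫ y, w y ∂P (V.X j ω, V.a j ω) - w (V.X j ω))) +
      γ * ∑ j ∈ Finset.range n, ψ j * (w (V.X j ω) - w (V.X (j + 1) ω)) +
      ∑ j ∈ Finset.range n,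
        γ * ψ j * (w (V.X (j + 1) ω) - ∫ y, w y ∂P (V.X j ω, V.a j ω)) := by
    rw [Finset.mul_sum, Finset.mul_sum, ← Finset.sum_add_distrib, ← Finset.sum_add_distrib]
    refine Finset.sum_congr rfl fun j _ => ?_
    ring
  rw [e]
  linarith

variable [OpensMeasurableSpace (E × U)]

theorem measurable_sum_reward (ψ : ℕ → ℝ) (n : ℕ) :
    Measurable fun ω => ∑ j ∈ Finset.range n, ψ j * c (V.X j ω, V.a j ω) :=
  Finset.measurable_fun_sum _ fun j _ =>
    (c.continuous.measurable.comp (V.measurable_pair j)).const_mul _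

theorem integrable_sum_reward (ψ : ℕ → ℝ) (n : ℕ) :
    Integrable (fun ω => ∑ j ∈ Finset.range n, ψ j * c (V.X j ω, V.a j ω)) V.μ :=
  Integrable.of_bound (V.measurable_sum_reward c ψ n).aestronglyMeasurable _
    (ae_of_all _ (V.abs_sum_reward_le c ψ n))

theorem integrable_exp_sum_reward (ψ : ℕ → ℝ) (γ : ℝ) (n : ℕ) :
    Integrable (fun ω => Real.exp
      (γ * ∑ j ∈ Finset.range n, ψ j * c (V.X j ω, V.a j ω))) V.μ := by
  refine Integrable.of_bound
    (Real.measurable_exp.comp ((V.measurable_sum_reward c ψ n).const_mul _)).aestronglyMeasurable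
    (Real.exp (|γ| * ((∑ j ∈ Finset.range n, |ψ j|) * ‖c‖))) (ae_of_all _ fun ω => ?_)
  rw [Real.norm_eq_abs, Real.abs_exp]
  refine Real.exp_le_exp.2 ((le_abs_self _).trans ?_)
  rw [abs_mul]
  exact mul_le_mul_of_nonneg_left (V.abs_sum_reward_le c ψ n ω) (abs_nonneg _)

/-- The factor `γ` inside the hypothesis lets one statement serve for upper bounds (`γ = 1`) and
lower bounds (`γ = -1`). -/
theorem mul_integral_sum_reward_le [IsMarkovKernel P] {ψ : ℕ → ℝ} (hanti : Antitone ψ)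
    (h0 : ∀ n, 0 ≤ ψ n) (h1 : ∀ n, ψ n ≤ 1) {w : E → ℝ} (hw : Measurable w) {K : ℝ}
    (hK : ∀ x, |w x| ≤ K) {γ ℓ : ℝ}
    (h : ∀ n ω, γ * (c (V.X n ω, V.a n ω) + ∫ y, w y ∂P (V.X n ω, V.a n ω) - w (V.X n ω)) ≤ γ * ℓ)
    (n : ℕ) :
    γ * ∫ ω, ∑ j ∈ Finset.range n, ψ j * c (V.X j ω, V.a j ω) ∂V.μ ≤
      γ * ℓ * (∑ j ∈ Finset.range n, ψ j) + 2 * K * |γ| := by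
  obtain ⟨hi, h2⟩ := V.integral_sum_martingale hw hK (fun j => γ * ψ j) n
  rw [← integral_const_mul]
  refine (integral_mono ((V.integrable_sum_reward c ψ n).const_mul γ)
    ((integrable_const _).add hi)
    fun ω => V.mul_sum_reward_le c hanti h0 h1 hK (fun n => h n ω) n).trans_eq ?_
  simp only [Pi.add_apply]
  rw [integral_add (integrable_const _) hi, h2]
  simp

theorem log_integral_exp_sum_reward_le [IsMarkovKernel P] {ψ : ℕ → ℝ} (hanti : Antitone ψ)
    (h0 : ∀ n, 0 ≤ ψ n) (h1 : ∀ n, ψ n ≤ 1) {w : E → ℝ} (hw : Measurable w) {K : ℝ}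
    (hK : ∀ x, |w x| ≤ K) {γ ℓ : ℝ}
    (h : ∀ n ω, γ * (c (V.X n ω, V.a n ω) + ∫ y, w y ∂P (V.X n ω, V.a n ω) - w (V.X n ω)) ≤ γ * ℓ)
    (n : ℕ) :
    Real.log (∫ ω, Real.exp (γ * ∑ j ∈ Finset.range n, ψ j * c (V.X j ω, V.a j ω)) ∂V.μ) ≤
      γ * ℓ * (∑ j ∈ Finset.range n, ψ j) + 2 * K * |γ| +
        K ^ 2 / 2 * γ ^ 2 * ∑ j ∈ Finset.range n, ψ j := by
  have hpos : 0 < ∫ ω, Real.exp (γ * ∑ j ∈ Finset.range n, ψ j * c (V.X j ω, V.a j ω)) ∂V.μ :=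
    integral_exp_pos (V.integrable_exp_sum_reward c ψ γ n)
  rw [Real.log_le_iff_le_exp hpos]
  rw [integral_eq_lintegral_of_nonneg_ae (ae_of_all _ fun ω => (Real.exp_pos _).le)
    (V.integrable_exp_sum_reward c ψ γ n).aestronglyMeasurable]
  refine ENNReal.toReal_le_of_le_ofReal (Real.exp_pos _).le ?_
  calc _ ≤ ∫⁻ ω, ENNReal.ofReal (Real.exp (γ * ℓ * (∑ j ∈ Finset.range n, ψ j) + 2 * K * |γ|)) *
        ENNReal.ofReal (Real.exp (∑ j ∈ Finset.range n,
          γ * ψ j * (w (V.X (j + 1) ω) - ∫ y, w y ∂P (V.X j ω, V.a j ω)))) ∂V.μ := by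
        refine lintegral_mono fun ω => ?_
        beta_reduce
        rw [← ENNReal.ofReal_mul (Real.exp_pos _).le, ← Real.exp_add]
        exact ENNReal.ofReal_le_ofReal (Real.exp_le_exp.2
          (V.mul_sum_reward_le c hanti h0 h1 hK (fun n => h n ω) n))
    _ ≤ ENNReal.ofReal (Real.exp (γ * ℓ * (∑ j ∈ Finset.range n, ψ j) + 2 * K * |γ|)) *
        ENNReal.ofReal (Real.exp (K ^ 2 / 2 * ∑ j ∈ Finset.range n, (γ * ψ j) ^ 2)) := by
        rw [lintegral_const_mul' _ _ ENNReal.ofReal_ne_top]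
        exact mul_le_mul_right (V.lintegral_exp_sum_martingale_le hw hK (fun j => γ * ψ j) n) _
    _ ≤ _ := by
        rw [← ENNReal.ofReal_mul (Real.exp_pos _).le, ← Real.exp_add]
        -- Since `0 ≤ ψ ≤ 1`, `ψ² ≤ ψ`. The variance term is thereby controlled by the same sum that
        -- normalises the reward.
        have h2 : ∑ j ∈ Finset.range n, (γ * ψ j) ^ 2 ≤ γ ^ 2 * ∑ j ∈ Finset.range n, ψ j := by
          rw [Finset.mul_sum]
          refine Finset.sum_le_sum fun j _ => ?_
          rw [mul_pow]
          exact mul_le_mul_of_nonneg_left (by nlinarith [h0 j, h1 j]) (sq_nonneg γ)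
        have h3 := mul_le_mul_of_nonneg_left h2 (by positivity : 0 ≤ K ^ 2 / 2)
        exact ENNReal.ofReal_le_ofReal (Real.exp_le_exp.2 (by linarith))

/-- Jensen's inequality for `exp`. -/
theorem mul_integral_le_log_integral_exp (ψ : ℕ → ℝ) (γ : ℝ) (n : ℕ) :
    γ * ∫ ω, ∑ j ∈ Finset.range n, ψ j * c (V.X j ω, V.a j ω) ∂V.μ ≤
      Real.log (∫ ω, Real.exp (γ * ∑ j ∈ Finset.range n, ψ j * c (V.X j ω, V.a j ω)) ∂V.μ) := by
  rw [Real.le_log_iff_exp_le (integral_exp_pos (V.integrable_exp_sum_reward c ψ γ n)),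
    ← integral_const_mul]
  exact convexOn_exp.map_integral_le Real.continuous_exp.continuousOn isClosed_univ
    (ae_of_all _ fun _ => Set.mem_univ _) ((V.integrable_sum_reward c ψ n).const_mul γ)
    (V.integrable_exp_sum_reward c ψ γ n)

end ControlledProcess

/-! ### Passage to the limit and divergence of shifted discount sums. -/

theorem liminf_coe_le_of_tendsto {u b : ℕ → ℝ} {ℓ : ℝ} (h : ∀ᶠ n in atTop, u n ≤ b n)
    (hb : Tendsto b atTop (𝓝 ℓ)) : liminf (fun n => (u n : EReal)) atTop ≤ (ℓ : EReal) :=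
  (liminf_le_liminf (h.mono fun _ hn => EReal.coe_le_coe_iff.2 hn)).trans_eq
    ((continuous_coe_real_ereal.tendsto ℓ).comp hb).liminf_eq

theorem le_liminf_coe_of_tendsto {u b : ℕ → ℝ} {ℓ : ℝ} (h : ∀ᶠ n in atTop, b n ≤ u n)
    (hb : Tendsto b atTop (𝓝 ℓ)) : (ℓ : EReal) ≤ liminf (fun n => (u n : EReal)) atTop :=
  ((continuous_coe_real_ereal.tendsto ℓ).comp hb).liminf_eq.symm.trans_le
    (liminf_le_liminf (h.mono fun _ hn => EReal.coe_le_coe_iff.2 hn))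

namespace IsDiscountFactor

variable {φ : ℕ → ℝ} (hφ : IsDiscountFactor φ)
include hφ

theorem antitone_shift (k : ℕ) : Antitone fun j => φ (k + j) := fun _ _ h =>
  hφ.antitone (Nat.add_le_add_left h k)

theorem tendsto_sum_shift (k : ℕ) :
    Tendsto (fun n : ℕ => ∑ j ∈ Finset.range n, φ (k + j)) atTop atTop := by
  have h : Tendsto (fun n : ℕ => (∑ i ∈ Finset.range (k + n), φ i) +
      -∑ i ∈ Finset.range k, φ i) atTop atTop := by
    exact tendsto_atTop_add_const_right _ _ (hφ.sum_eq_top.comp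
      ((tendsto_add_atTop_nat k).congr fun n => add_comm n k))
  refine h.congr fun n => ?_
  rw [Finset.sum_range_add]
  ring

end IsDiscountFactor

theorem isDiscountFactor_one : IsDiscountFactor fun _ => 1 where
  nonneg _ := zero_le_one
  le_one _ := le_rfl
  zero := rfl
  antitone := antitone_const
  supermul _ _ := (one_mul _).le
  sum_eq_top := by simpa using tendsto_natCast_atTop_atTop (R := ℝ)

theorem tendsto_const_add_div_atTop {S : ℕ → ℝ} (hS : Tendsto S atTop atTop) (a C : ℝ) :
    Tendsto (fun n => a + C / S n) atTop (𝓝 a) := by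
  simpa using tendsto_const_nhds.add (hS.const_div_atTop C)

/-! ### Bounds on the reward functionals from one-sided drift conditions. -/

namespace ControlledProcess

variable {E : Type u} {U : Type v} [MeasurableSpace E] [MeasurableSpace U]
  {P : Kernel (E × U) E} {x : E} (V : ControlledProcess P x)
  [TopologicalSpace E] [TopologicalSpace U]
  (c : E × U →ᵇ ℝ) {w : E → ℝ} {K : ℝ} {ℓ : ℝ}

theorem riskReward_eq_discountedRiskReward (γ : ℝ) :
    riskReward c γ V = discountedRiskReward c (fun _ => 1) γ 0 V := by
  simp [riskReward, discountedRiskReward, mul_comm]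

variable [OpensMeasurableSpace (E × U)] [IsMarkovKernel P] (hw : Measurable w) (hK : ∀ x, |w x| ≤ K)
include hw hK

theorem averageReward_le
    (h : ∀ n ω, c (V.X n ω, V.a n ω) + ∫ y, w y ∂P (V.X n ω, V.a n ω) - w (V.X n ω) ≤ ℓ) :
    averageReward c V ≤ ℓ := by
  refine liminf_coe_le_of_tendsto ?_
    (tendsto_const_add_div_atTop tendsto_natCast_atTop_atTop ℓ (2 * K))
  filter_upwards [eventually_gt_atTop 0] with n hn
  have hn' : (0 : ℝ) < n := Nat.cast_pos.2 hn
  have h1 := V.mul_integral_sum_reward_le c (ψ := fun _ => 1) (γ := 1) (ℓ := ℓ) antitone_const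
    (fun _ => zero_le_one) (fun _ => le_rfl) hw hK (by simpa using h) n
  simp only [one_mul, abs_one, mul_one, Finset.sum_const, Finset.card_range, nsmul_eq_mul] at h1
  rw [one_div, inv_mul_le_iff₀ hn']
  refine h1.trans_eq ?_
  field_simp

theorem le_averageReward
    (h : ∀ n ω, ℓ ≤ c (V.X n ω, V.a n ω) + ∫ y, w y ∂P (V.X n ω, V.a n ω) - w (V.X n ω)) :
    ℓ ≤ averageReward c V := by
  refine le_liminf_coe_of_tendsto ?_
    (tendsto_const_add_div_atTop tendsto_natCast_atTop_atTop ℓ (-(2 * K)))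
  filter_upwards [eventually_gt_atTop 0] with n hn
  have hn' : (0 : ℝ) < n := Nat.cast_pos.2 hn
  have h1 := V.mul_integral_sum_reward_le c (ψ := fun _ => 1) (γ := -1) (ℓ := ℓ) antitone_const
    (fun _ => zero_le_one) (fun _ => le_rfl) hw hK
    (fun n ω => by linarith [h n ω]) n
  simp only [one_mul, abs_neg, abs_one, mul_one, Finset.sum_const, Finset.card_range,
    nsmul_eq_mul] at h1
  rw [one_div, le_inv_mul_iff₀ hn']
  refine le_trans (le_of_eq ?_) (show (n : ℝ) * ℓ - 2 * K ≤ _ by linarith)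
  field_simp
  ring

variable {φ : ℕ → ℝ} (hφ : IsDiscountFactor φ) (k : ℕ) {γ : ℝ}
include hφ

/-- Risk aversion can only decrease the reward. -/
theorem discountedRiskReward_le_of_neg (hγ : γ < 0)
    (h : ∀ n ω, c (V.X n ω, V.a n ω) + ∫ y, w y ∂P (V.X n ω, V.a n ω) - w (V.X n ω) ≤ ℓ) :
    discountedRiskReward c φ γ k V ≤ ℓ := by
  have hS := hφ.tendsto_sum_shift k
  refine liminf_coe_le_of_tendsto ?_ (tendsto_const_add_div_atTop hS ℓ (2 * K))
  filter_upwards [hS.eventually_gt_atTop 0] with n hn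
  -- The expectation is bounded with parameter `1`; the actual `γ` enters only through Jensen, so no
  -- error in `γ` arises.
  have h1 := V.mul_integral_sum_reward_le c (ψ := fun j => φ (k + j)) (γ := 1) (ℓ := ℓ)
    (hφ.antitone_shift k) (fun _ => hφ.nonneg _) (fun _ => hφ.le_one _) hw hK (by simpa using h) n
  have h2 := V.mul_integral_le_log_integral_exp c (fun j => φ (k + j)) γ n
  rw [inv_mul_eq_div, div_le_iff_of_neg (mul_neg_of_neg_of_pos hγ hn)]
  refine le_trans ?_ h2
  have e : (ℓ + 2 * K / ∑ j ∈ Finset.range n, φ (k + j)) *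
      (γ * ∑ j ∈ Finset.range n, φ (k + j)) =
      γ * (ℓ * ∑ j ∈ Finset.range n, φ (k + j) + 2 * K) := by
    field_simp
  rw [e]
  refine mul_le_mul_of_nonpos_left ?_ hγ.le
  simpa using h1

theorem le_discountedRiskReward_of_pos (hγ : 0 < γ)
    (h : ∀ n ω, ℓ ≤ c (V.X n ω, V.a n ω) + ∫ y, w y ∂P (V.X n ω, V.a n ω) - w (V.X n ω)) :
    ℓ ≤ discountedRiskReward c φ γ k V := by
  have hS := hφ.tendsto_sum_shift k
  refine le_liminf_coe_of_tendsto ?_ (tendsto_const_add_div_atTop hS ℓ (-(2 * K)))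
  filter_upwards [hS.eventually_gt_atTop 0] with n hn
  have h1 := V.mul_integral_sum_reward_le c (ψ := fun j => φ (k + j)) (γ := -1) (ℓ := ℓ)
    (hφ.antitone_shift k) (fun _ => hφ.nonneg _) (fun _ => hφ.le_one _) hw hK
    (fun n ω => by linarith [h n ω]) n
  have h2 := V.mul_integral_le_log_integral_exp c (fun j => φ (k + j)) γ n
  rw [inv_mul_eq_div, le_div_iff₀ (mul_pos hγ hn)]
  refine le_trans ?_ h2
  have e : (ℓ + -(2 * K) / ∑ j ∈ Finset.range n, φ (k + j)) *
      (γ * ∑ j ∈ Finset.range n, φ (k + j)) =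
      γ * (ℓ * ∑ j ∈ Finset.range n, φ (k + j) - 2 * K) := by
    field_simp
    ring
  rw [e]
  refine mul_le_mul_of_nonneg_left ?_ hγ.le
  simp only [abs_neg, abs_one] at h1
  linarith

/-- Dividing by the negative normaliser turns the upper bound on the logarithm into a lower bound on
the reward. The error depends on `w` only through `K`, and not on `k` or `x`. -/
theorem le_discountedRiskReward_of_neg (hγ : γ < 0)
    (h : ∀ n ω, ℓ ≤ c (V.X n ω, V.a n ω) + ∫ y, w y ∂P (V.X n ω, V.a n ω) - w (V.X n ω)) :
    ((ℓ + K ^ 2 / 2 * γ : ℝ) : EReal) ≤ discountedRiskReward c φ γ k V := by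
  have hS := hφ.tendsto_sum_shift k
  refine le_liminf_coe_of_tendsto ?_
    (tendsto_const_add_div_atTop hS (ℓ + K ^ 2 / 2 * γ) (-(2 * K)))
  filter_upwards [hS.eventually_gt_atTop 0] with n hn
  have h1 := V.log_integral_exp_sum_reward_le c (ψ := fun j => φ (k + j)) (γ := γ) (ℓ := ℓ)
    (hφ.antitone_shift k) (fun _ => hφ.nonneg _) (fun _ => hφ.le_one _) hw hK
    (fun n ω => mul_le_mul_of_nonpos_left (h n ω) hγ.le) n
  rw [inv_mul_eq_div, le_div_iff_of_neg (mul_neg_of_neg_of_pos hγ hn)]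
  refine h1.trans_eq ?_
  rw [abs_of_neg hγ]
  field_simp
  ring

theorem discountedRiskReward_le_of_pos (hγ : 0 < γ)
    (h : ∀ n ω, c (V.X n ω, V.a n ω) + ∫ y, w y ∂P (V.X n ω, V.a n ω) - w (V.X n ω) ≤ ℓ) :
    discountedRiskReward c φ γ k V ≤ ((ℓ + K ^ 2 / 2 * γ : ℝ) : EReal) := by
  have hS := hφ.tendsto_sum_shift k
  refine liminf_coe_le_of_tendsto ?_
    (tendsto_const_add_div_atTop hS (ℓ + K ^ 2 / 2 * γ) (2 * K))
  filter_upwards [hS.eventually_gt_atTop 0] with n hn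
  have h1 := V.log_integral_exp_sum_reward_le c (ψ := fun j => φ (k + j)) (γ := γ) (ℓ := ℓ)
    (hφ.antitone_shift k) (fun _ => hφ.nonneg _) (fun _ => hφ.le_one _) hw hK
    (fun n ω => mul_le_mul_of_nonneg_left (h n ω) hγ.le) n
  rw [inv_mul_eq_div, div_le_iff₀ (mul_pos hγ hn)]
  refine h1.trans_eq ?_
  rw [abs_of_pos hγ]
  field_simp
  ring

end ControlledProcess

/-! ### Suprema over controls and measurable selection. -/

/-- The supremum over a compact set of parameters of a bounded continuous function is again
bounded and continuous. -/
theorem exists_boundedContinuous_isLUB {E : Type u} {U : Type v} [TopologicalSpace E]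
    [TopologicalSpace U] [CompactSpace U] [Nonempty U] {F : E × U → ℝ} (hF : Continuous F) {C : ℝ}
    (hC : ∀ z, |F z| ≤ C) :
    ∃ G : E →ᵇ ℝ, ∀ x, IsLUB (Set.range fun a : U => F (x, a)) (G x) := by
  have hne : ∀ x, (Set.range fun a : U => F (x, a)).Nonempty := fun x => Set.range_nonempty _
  have hbdd : ∀ x, BddAbove (Set.range fun a : U => F (x, a)) := fun x =>
    ⟨C, by rintro _ ⟨a, rfl⟩; exact (abs_le.1 (hC _)).2⟩
  have hcont : Continuous fun x => sSup (Set.range fun a : U => F (x, a)) := by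
    simpa only [Set.image_univ] using
      isCompact_univ.continuous_sSup (f := fun x a => F (x, a)) (K := (Set.univ : Set U)) hF
  refine ⟨BoundedContinuousFunction.ofNormedAddCommGroup _ hcont C fun x => ?_, fun x =>
    isLUB_csSup (hne x) (hbdd x)⟩
  obtain ⟨a⟩ := ‹Nonempty U›
  rw [Real.norm_eq_abs, abs_le]
  constructor
  · exact (abs_le.1 (hC (x, a))).1.trans (le_csSup (hbdd x) ⟨a, rfl⟩)
  · refine csSup_le (hne x) ?_
    rintro _ ⟨a, rfl⟩
    exact (abs_le.1 (hC _)).2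

/-- Measurable selection of nearly optimal parameters. -/
theorem exists_measurable_sub_le {E : Type u} {U : Type v} [TopologicalSpace E]
    [MeasurableSpace E] [OpensMeasurableSpace E] [TopologicalSpace U]
    [TopologicalSpace.SeparableSpace U] [Nonempty U] [MeasurableSpace U]
    {F : E × U → ℝ} (hF : Continuous F) {g : E → ℝ} (hg : Measurable g)
    (h : ∀ x, IsLUB (Set.range fun a : U => F (x, a)) (g x)) {e : ℝ} (he : 0 < e) :
    ∃ f : E → U, Measurable f ∧ ∀ x, g x - e ≤ F (x, f x) := by
  classical
  have hex : ∀ x, ∃ n, g x - e < F (x, TopologicalSpace.denseSeq U n) := by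
    intro x
    obtain ⟨_, ⟨a, rfl⟩, ha, -⟩ := (h x).exists_between (sub_lt_self _ he)
    -- Strict inequality is an open condition on the control, so some term of a dense sequence
    -- satisfies it; the first such index depends measurably on `x`.
    have ho : IsOpen {a : U | g x - e < F (x, a)} :=
      isOpen_lt continuous_const (hF.comp (by fun_prop))
    obtain ⟨_, hb, n, rfl⟩ := (TopologicalSpace.denseRange_denseSeq U).inter_open_nonempty _ ho ⟨a, ha⟩
    exact ⟨n, hb⟩
  refine ⟨fun x => TopologicalSpace.denseSeq U (Nat.find (hex x)),
    Measurable.find (f := fun n _ => TopologicalSpace.denseSeq U n) (fun n => measurable_const)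
      (fun n => ?_) hex, fun x => (Nat.find_spec (hex x)).le⟩
  exact measurableSet_lt (hg.sub_const _) (hF.comp (by fun_prop)).measurable

/-! ### Consequences of the density bounds; Bellman and Poisson equations. -/

section Density

variable {E : Type u} {U : Type v} [MeasurableSpace E] [MeasurableSpace U] [TopologicalSpace E]
  [TopologicalSpace U] {P : Kernel (E × U) E}

/-- The transition probabilities dominate a multiple of a fixed probability measure. -/
theorem HasBoundedDensity.exists_minorization [Nonempty U] [IsMarkovKernel P]
    (hP : HasBoundedDensity P) :
    ∃ (η : Measure E) (β : ℝ), IsProbabilityMeasure η ∧ 0 < β ∧ β ≤ 1 ∧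
      ∀ z, ENNReal.ofReal β • η ≤ P z := by
  obtain ⟨η, p, M, hη, hM, -, -, hb, hd⟩ := hP
  have hle : ∀ z, ENNReal.ofReal (1 / M) • η ≤ P z := by
    intro z
    refine Measure.le_iff.2 fun B hB => ?_
    rw [hd z.1 z.2 B hB, Measure.smul_apply, smul_eq_mul, ← setLIntegral_const]
    exact lintegral_mono fun y => ENNReal.ofReal_le_ofReal (hb _ _ _).1
  refine ⟨η, 1 / M, hη, by positivity, ?_, hle⟩
  obtain ⟨x⟩ : Nonempty E := nonempty_of_isProbabilityMeasure η
  obtain ⟨a⟩ := ‹Nonempty U›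
  -- Comparing total masses gives `1 / M ≤ 1`.
  have h := hle (x, a) Set.univ
  simpa using h

/-- Transition kernels with bounded densities that depend continuously on state and control have
the strong Feller property. -/
theorem HasBoundedDensity.continuous_integral [FirstCountableTopology (E × U)]
    (hP : HasBoundedDensity P) {w : E → ℝ} (hw : Measurable w) {K : ℝ} (hK : ∀ x, |w x| ≤ K) :
    Continuous fun z => ∫ y, w y ∂P z := by
  obtain ⟨η, p, M, hη, hM, hm, hc, hb, hd⟩ := hP
  have hp0 : ∀ x a y, 0 ≤ p x a y := fun x a y => le_trans (by positivity) (hb x a y).1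
  have hP' : ∀ z, P z = η.withDensity fun y => ENNReal.ofReal (p z.1 z.2 y) := by
    intro z
    ext B hB
    rw [hd z.1 z.2 B hB, withDensity_apply _ hB]
  have hI : ∀ z, ∫ y, w y ∂P z = ∫ y, p z.1 z.2 y * w y ∂η := by
    intro z
    rw [hP' z, integral_withDensity_eq_integral_toReal_smul (hm _ _).ennreal_ofReal
      (ae_of_all _ fun _ => ENNReal.ofReal_lt_top)]
    simp only [ENNReal.toReal_ofReal (hp0 _ _ _), smul_eq_mul]
  simp_rw [hI]
  refine continuous_of_dominated (bound := fun _ => M * K)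
    (fun z => ((hm _ _).mul hw).aestronglyMeasurable) (fun z => ae_of_all _ fun y => ?_)
    (integrable_const _) (ae_of_all _ fun y => (hc y).mul continuous_const)
  rw [Real.norm_eq_abs, abs_mul, abs_of_nonneg (hp0 _ _ _)]
  exact mul_le_mul (hb _ _ _).2 (hK y) (abs_nonneg _) hM.le

/-- `ν - βη` is a positive measure of mass `1 - β`, so it moves the integrals of `w` and `w'` apart
by at most `(1 - β) * dist w w'`. To avoid subtracting measures, the nonnegative function `dist w w'
- (w - w')` is integrated against both sides of `βη ≤ ν`. -/
theorem integral_sub_le_of_minorization [OpensMeasurableSpace E] {ν η : Measure E}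
    [IsProbabilityMeasure ν] [IsProbabilityMeasure η] {β : ℝ} (hβ : 0 ≤ β)
    (h : ENNReal.ofReal β • η ≤ ν) (w w' : E →ᵇ ℝ) :
    ∫ y, w y ∂ν - β * ∫ y, w y ∂η ≤
      ∫ y, w' y ∂ν - β * ∫ y, w' y ∂η + (1 - β) * dist w w' := by
  have hi : ∀ (μ : Measure E) [IsProbabilityMeasure μ] (v : E →ᵇ ℝ), Integrable v μ :=
    fun μ _ v => v.integrable μ
  have hD : ∀ y, 0 ≤ dist w w' - (w y - w' y) := fun y =>
    sub_nonneg.2 ((le_abs_self _).trans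
      ((Real.dist_eq _ _).symm.trans_le (BoundedContinuousFunction.dist_coe_le_dist y)))
  have hint : ∀ (μ : Measure E) [IsProbabilityMeasure μ],
      ∫ y, (dist w w' - (w y - w' y)) ∂μ = dist w w' - (∫ y, w y ∂μ - ∫ y, w' y ∂μ) := by
    intro μ _
    have hs : Integrable (fun y => w y - w' y) μ := (hi μ w).sub (hi μ w')
    rw [integral_sub (integrable_const _) hs,
      integral_sub (hi μ w) (hi μ w')]
    simp
  have hmono := integral_mono_measure h (ae_of_all _ hD)
    ((integrable_const _).sub ((hi ν w).sub (hi ν w')))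
  rw [integral_smul_measure, ENNReal.toReal_ofReal hβ, smul_eq_mul, hint, hint] at hmono
  linarith

/-- The Bellman equation is solved by the fixed point of the dynamic programming operator of the
kernel from which the minorizing measure has been subtracted. -/
theorem HasBoundedDensity.exists_isBellmanConstant [FirstCountableTopology (E × U)]
    [OpensMeasurableSpace E] [CompactSpace U] [Nonempty U] [IsMarkovKernel P]
    (hP : HasBoundedDensity P) (c : E × U →ᵇ ℝ) : ∃ ℓ, IsBellmanConstant P c ℓ := by
  obtain ⟨η, β, hη, hβ, hβ1, hle⟩ := hP.exists_minorization
  let F : (E →ᵇ ℝ) → E × U → ℝ := fun w z => c z + (∫ y, w y ∂P z - β * ∫ y, w y ∂η)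
  have hF : ∀ w, Continuous (F w) := fun w =>
    c.continuous.add ((hP.continuous_integral w.continuous.measurable
      (fun x => w.norm_coe_le_norm x)).sub continuous_const)
  have hFC : ∀ w z, |F w z| ≤ ‖c‖ + (‖w‖ + β * ‖w‖) := by
    intro w z
    have hb : ∀ (μ : Measure E) [IsProbabilityMeasure μ], |∫ y, w y ∂μ| ≤ ‖w‖ := fun μ _ => by
      simpa using norm_integral_le_of_norm_le_const (μ := μ) (f := w)
        (ae_of_all _ w.norm_coe_le_norm)
    refine (abs_add_le _ _).trans (add_le_add (c.norm_coe_le_norm z) ((abs_sub _ _).trans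
      (add_le_add (hb _) ?_)))
    rw [abs_mul, abs_of_pos hβ]
    exact mul_le_mul_of_nonneg_left (hb _) hβ.le
  choose T hT using fun w => exists_boundedContinuous_isLUB (hF w) (hFC w)
  have hTle : ∀ w w' x, T w x ≤ T w' x + (1 - β) * dist w w' := by
    intro w w' x
    refine (hT w x).2 ?_
    rintro _ ⟨a, rfl⟩
    have h1 : F w' (x, a) ≤ T w' x := (hT w' x).1 ⟨a, rfl⟩
    have h2 := integral_sub_le_of_minorization hβ.le (hle (x, a)) w w'
    simp only [F] at h1 ⊢
    linarith
  have hq : 0 ≤ 1 - β := sub_nonneg.2 hβ1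
  have hcontr : ContractingWith (1 - β).toNNReal T := by
    refine ⟨Real.toNNReal_lt_one.2 (sub_lt_self _ hβ), LipschitzWith.of_dist_le_mul fun w w' => ?_⟩
    rw [Real.coe_toNNReal _ hq]
    refine (BoundedContinuousFunction.dist_le (mul_nonneg hq dist_nonneg)).2 fun x => ?_
    rw [Real.dist_eq, abs_le]
    have h1 := hTle w w' x
    have h2 := hTle w' w x
    rw [dist_comm w' w] at h2
    constructor <;> linarith
  obtain ⟨w, hw⟩ : ∃ w, T w = w := ⟨_, hcontr.fixedPoint_isFixedPt⟩
  -- The constant subtracted in the operator, evaluated at the fixed point, is the Bellman constant.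
  refine ⟨β * ∫ y, w y ∂η, w, fun x => ?_⟩
  have h := hT w x
  rw [hw] at h
  have e : (fun a : U => c (x, a) - β * ∫ y, w y ∂η + ∫ y, w y ∂P (x, a)) =
      fun a => F w (x, a) := by
    funext a
    simp only [F]
    ring
  rwa [e]

/-- The Poisson equation of a continuous stationary control is a Bellman equation with a single
control. -/
theorem HasBoundedDensity.exists_isPoissonConstant [FirstCountableTopology E]
    [OpensMeasurableSpace E] [IsMarkovKernel P]
    (hP : HasBoundedDensity P) (c : E × U →ᵇ ℝ) {f : E → U} (hf : Continuous f)
    (hfm : Measurable f) : ∃ ℓ, IsPoissonConstant P c f ℓ := by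
  let Q : Kernel (E × PUnit.{v + 1}) E := P.comap (fun z => (z.1, f z.1))
    (measurable_fst.prodMk (hfm.comp measurable_fst))
  have hQ : HasBoundedDensity Q := by
    obtain ⟨η, p, M, hη, hM, hm, hc, hb, hd⟩ := hP
    exact ⟨η, fun x _ => p x (f x), M, hη, hM, fun x _ => hm _ _,
      fun y => (hc y).comp (f := fun z : E × PUnit.{v + 1} => (z.1, f z.1)) (by fun_prop),
      fun x _ => hb _ _, fun x _ => hd _ _⟩
  obtain ⟨ℓ, w, hw⟩ := hQ.exists_isBellmanConstant
    (c.compContinuous ⟨fun z : E × PUnit.{v + 1} => (z.1, f z.1), by fun_prop⟩)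
  refine ⟨ℓ, w, w.continuous.measurable, ⟨‖w‖, w.norm_coe_le_norm⟩, fun x => ?_⟩
  -- With one control the supremum is the single value, so the Bellman equation is an equality.
  refine (hw x).unique ?_
  rw [Set.range_unique]
  exact isLUB_singleton

end Density

/-! ### Reward of a stationary control with a Poisson solution. -/

section Stationary

variable {E : Type u} {U : Type v} [MeasurableSpace E] [MeasurableSingletonClass E]
  [MeasurableSpace U] [TopologicalSpace E] [TopologicalSpace U] [OpensMeasurableSpace (E × U)]
  {P : Kernel (E × U) E} [IsMarkovKernel P] (c : E × U →ᵇ ℝ) {f : E → U} (hf : Measurable f)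
  {φ : ℕ → ℝ} {ℓ : ℝ}

theorem IsPoissonConstant.averageReward_eq (h : IsPoissonConstant P c f ℓ) (x : E) :
    averageReward c (stationary P f hf x) = ℓ := by
  obtain ⟨w, hw, ⟨K, hK⟩, he⟩ := h
  have hr : ∀ y, c (y, f y) + ∫ z, w z ∂P (y, f y) - w y = ℓ := fun y => by linarith [he y]
  refine le_antisymm (ControlledProcess.averageReward_le _ c hw hK fun n ω =>
      (hr ((stationary P f hf x).X n ω)).le)
    (ControlledProcess.le_averageReward _ c hw hK fun n ω =>
      (hr ((stationary P f hf x).X n ω)).ge)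

/-- `C` precedes `γ`, `k` and `x`, which allows a threshold for `γ` common to all `k` and `x`. -/
theorem IsPoissonConstant.exists_le_discountedRiskReward (h : IsPoissonConstant P c f ℓ)
    (hφ : IsDiscountFactor φ) :
    ∃ C : ℝ, 0 ≤ C ∧ ∀ γ < 0, ∀ k x,
      ((ℓ + C * γ : ℝ) : EReal) ≤ discountedRiskReward c φ γ k (stationary P f hf x) := by
  obtain ⟨w, hw, ⟨K, hK⟩, he⟩ := h
  have hr : ∀ y, c (y, f y) + ∫ z, w z ∂P (y, f y) - w y = ℓ := fun y => by linarith [he y]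
  refine ⟨K ^ 2 / 2, by positivity, fun γ hγ k x =>
    ControlledProcess.le_discountedRiskReward_of_neg _ c hw hK hφ k hγ fun n ω =>
      (hr ((stationary P f hf x).X n ω)).ge⟩

theorem IsPoissonConstant.tendsto_discountedRiskReward (h : IsPoissonConstant P c f ℓ)
    (hφ : IsDiscountFactor φ) (k : ℕ) (x : E) :
    Tendsto (fun γ : ℝ => discountedRiskReward c φ γ k (stationary P f hf x))
      (𝓝[>] 0) (𝓝 (ℓ : EReal)) := by
  obtain ⟨w, hw, ⟨K, hK⟩, he⟩ := h
  have hr : ∀ y, c (y, f y) + ∫ z, w z ∂P (y, f y) - w y = ℓ := fun y => by linarith [he y]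
  have hlim : Tendsto (fun γ : ℝ => ((ℓ + K ^ 2 / 2 * γ : ℝ) : EReal)) (𝓝[>] 0)
      (𝓝 (ℓ : EReal)) := by
    refine (continuous_coe_real_ereal.tendsto ℓ).comp (tendsto_nhdsWithin_of_tendsto_nhds ?_)
    exact Continuous.tendsto' (by fun_prop) _ _ (by simp)
  refine tendsto_of_tendsto_of_tendsto_of_le_of_le' tendsto_const_nhds hlim ?_ ?_ <;>
  filter_upwards [self_mem_nhdsWithin] with γ hγ
  · exact ControlledProcess.le_discountedRiskReward_of_pos _ c hw hK hφ k hγ fun n ω =>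
      (hr ((stationary P f hf x).X n ω)).ge
  · exact ControlledProcess.discountedRiskReward_le_of_pos _ c hw hK hφ k hγ fun n ω =>
      (hr ((stationary P f hf x).X n ω)).le

end Stationary

/-! ### Values of the control problems from the Bellman equation. -/

section Bellman

variable {E : Type u} {U : Type v} [MeasurableSpace E] [MeasurableSpace U] [TopologicalSpace E]
  [TopologicalSpace U] [OpensMeasurableSpace E] [OpensMeasurableSpace (E × U)]
  {P : Kernel (E × U) E} [IsMarkovKernel P] (c : E × U →ᵇ ℝ) {φ : ℕ → ℝ} {ℓ : ℝ}

theorem IsBellmanConstant.averageValue_le (h : IsBellmanConstant P c ℓ) (x : E) :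
    averageValue P c x ≤ ℓ := by
  obtain ⟨w, hw⟩ := h
  refine iSup_le fun V => V.averageReward_le c w.continuous.measurable w.norm_coe_le_norm
    fun n ω => ?_
  linarith [(hw (V.X n ω)).1 ⟨V.a n ω, rfl⟩]

theorem IsBellmanConstant.discountedRiskValue_le (h : IsBellmanConstant P c ℓ)
    (hφ : IsDiscountFactor φ) {γ : ℝ} (hγ : γ < 0) (k : ℕ) (x : E) :
    discountedRiskValue P c φ γ k x ≤ ℓ := by
  obtain ⟨w, hw⟩ := h
  refine iSup_le fun V => V.discountedRiskReward_le_of_neg c w.continuous.measurable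
    w.norm_coe_le_norm hφ k hγ fun n ω => ?_
  linarith [(hw (V.X n ω)).1 ⟨V.a n ω, rfl⟩]

/-- Nearly optimal stationary controls for the Bellman equation. -/
theorem IsBellmanConstant.exists_stationary [MeasurableSingletonClass E]
    [FirstCountableTopology (E × U)]
    [TopologicalSpace.SeparableSpace U] [Nonempty U] (hP : HasBoundedDensity P)
    (h : IsBellmanConstant P c ℓ) :
    ∃ C : ℝ, ∀ e > 0, ∃ (f : E → U) (hf : Measurable f), ∀ x,
      ((ℓ - e : ℝ) : EReal) ≤ averageReward c (stationary P f hf x) ∧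
      ∀ φ, IsDiscountFactor φ → ∀ γ < 0, ∀ k,
        ((ℓ - e + C * γ : ℝ) : EReal) ≤
          discountedRiskReward c φ γ k (stationary P f hf x) := by
  obtain ⟨w, hw⟩ := h
  have hwm := w.continuous.measurable
  -- The constant depends on `w` alone and not on the selector, so `e` can later tend to `0` with
  -- `γ` fixed.
  refine ⟨‖w‖ ^ 2 / 2, fun e he => ?_⟩
  have hc : Continuous fun z : E × U => c z - ℓ + ∫ y, w y ∂P z :=
    (c.continuous.sub continuous_const).add (hP.continuous_integral hwm w.norm_coe_le_norm)
  obtain ⟨f, hf, hfw⟩ := exists_measurable_sub_le hc hwm hw he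
  have hr : ∀ y, ℓ - e ≤ c (y, f y) + ∫ z, w z ∂P (y, f y) - w y := fun y => by
    linarith [hfw y]
  exact ⟨f, hf, fun x => ⟨ControlledProcess.le_averageReward _ c hwm w.norm_coe_le_norm
      fun n ω => hr ((stationary P f hf x).X n ω),
    fun φ hφ γ hγ k => ControlledProcess.le_discountedRiskReward_of_neg _ c hwm
      w.norm_coe_le_norm hφ k hγ fun n ω => hr ((stationary P f hf x).X n ω)⟩⟩

theorem IsBellmanConstant.averageValue_eq [MeasurableSingletonClass E]
    [FirstCountableTopology (E × U)]
    [TopologicalSpace.SeparableSpace U] [Nonempty U] (hP : HasBoundedDensity P)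
    (h : IsBellmanConstant P c ℓ) (x : E) : averageValue P c x = ℓ := by
  obtain ⟨C, hC⟩ := h.exists_stationary c hP
  refine le_antisymm (h.averageValue_le c x) ?_
  refine EReal.ge_of_forall_gt_iff_ge.1 fun z hz => ?_
  obtain ⟨f, hf, hx⟩ := hC (ℓ - z) (sub_pos.2 (EReal.coe_lt_coe_iff.1 hz))
  refine le_trans ?_ (le_iSup (fun V : ControlledProcess P x => averageReward c V)
    (stationary P f hf x))
  simpa using (hx x).1

theorem IsBellmanConstant.exists_le_discountedRiskValue [MeasurableSingletonClass E]
    [FirstCountableTopology (E × U)]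
    [TopologicalSpace.SeparableSpace U] [Nonempty U] (hP : HasBoundedDensity P)
    (h : IsBellmanConstant P c ℓ) (hφ : IsDiscountFactor φ) :
    ∃ C : ℝ, ∀ γ < 0, ∀ k x, ((ℓ + C * γ : ℝ) : EReal) ≤ discountedRiskValue P c φ γ k x := by
  obtain ⟨C, hC⟩ := h.exists_stationary c hP
  refine ⟨C, fun γ hγ k x => EReal.ge_of_forall_gt_iff_ge.1 fun z hz => ?_⟩
  -- This tolerance makes the guaranteed reward exactly `z`, an arbitrary real below the target.
  obtain ⟨f, hf, hx⟩ := hC (ℓ + C * γ - z) (sub_pos.2 (EReal.coe_lt_coe_iff.1 hz))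
  refine le_trans ?_ (le_iSup (fun V : ControlledProcess P x => discountedRiskReward c φ γ k V)
    (stationary P f hf x))
  have e : ℓ - (ℓ + C * γ - z) + C * γ = z := by ring
  simpa only [e] using (hx x).2 φ hφ γ hγ k

theorem IsBellmanConstant.tendsto_discountedRiskValue [MeasurableSingletonClass E]
    [FirstCountableTopology (E × U)]
    [TopologicalSpace.SeparableSpace U] [Nonempty U] (hP : HasBoundedDensity P)
    (h : IsBellmanConstant P c ℓ) (hφ : IsDiscountFactor φ) (k : ℕ) (x : E) :
    Tendsto (fun γ : ℝ => discountedRiskValue P c φ γ k x) (𝓝[<] 0) (𝓝 (ℓ : EReal)) := by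
  obtain ⟨C, hC⟩ := h.exists_le_discountedRiskValue c hP hφ
  have hlim : Tendsto (fun γ : ℝ => ((ℓ + C * γ : ℝ) : EReal)) (𝓝[<] 0) (𝓝 (ℓ : EReal)) := by
    refine (continuous_coe_real_ereal.tendsto ℓ).comp (tendsto_nhdsWithin_of_tendsto_nhds ?_)
    exact Continuous.tendsto' (by fun_prop) _ _ (by simp)
  refine tendsto_of_tendsto_of_tendsto_of_le_of_le' hlim tendsto_const_nhds ?_ ?_ <;>
  filter_upwards [self_mem_nhdsWithin] with γ hγ
  · exact hC γ hγ k x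
  · exact h.discountedRiskValue_le c hφ hγ k x

end Bellman

/-! ### Assembly of the three claims. -/

theorem theorem5 {E : Type u} {U : Type v}
    [MetricSpace E] [LocallyCompactSpace E] [SecondCountableTopology E]
    [MeasurableSpace E] [BorelSpace E]
    [MetricSpace U] [CompactSpace U] [Nonempty U] [MeasurableSpace U] [BorelSpace U]
    (P : Kernel (E × U) E) [IsMarkovKernel P] (hP : HasBoundedDensity P)
    (c : E × U →ᵇ ℝ) (φ : ℕ → ℝ) (hφ : IsDiscountFactor φ) :
    (∃ ℓ : ℝ, IsBellmanConstant P c ℓ ∧ (∀ x : E, averageValue P c x = (ℓ : EReal)) ∧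
      ∀ (k : ℕ) (x : E),
        Tendsto (fun γ : ℝ => discountedRiskValue P c φ γ k x) (𝓝[<] 0) (𝓝 (ℓ : EReal))) ∧
    (∀ (f : E → U) (hf : Continuous f) (ε : ℝ), 0 ≤ ε →
      (∀ x : E, averageValue P c x ≤
        averageReward c (stationary P f hf.measurable x) + (ε : EReal)) →
      ∀ δ : ℝ, 0 < δ → ∃ γ₀ : ℝ, γ₀ < 0 ∧ ∀ γ : ℝ, γ₀ < γ → γ < 0 → ∀ (k : ℕ) (x : E),
        discountedRiskValue P c φ γ k x ≤
          discountedRiskReward c φ γ k (stationary P f hf.measurable x) +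
            ((ε + δ : ℝ) : EReal)) ∧
    (∀ (f : E → U) (hf : Continuous f), ∃ ℓ : ℝ, IsPoissonConstant P c f ℓ ∧
      (∀ x : E, averageReward c (stationary P f hf.measurable x) = (ℓ : EReal)) ∧
      ∀ (k : ℕ) (x : E),
        Tendsto (fun γ : ℝ => discountedRiskReward c φ γ k (stationary P f hf.measurable x))
          (𝓝[>] 0) (𝓝 (ℓ : EReal)) ∧
        Tendsto (fun γ : ℝ => riskReward c γ (stationary P f hf.measurable x))
          (𝓝[>] 0) (𝓝 (ℓ : EReal))) := by
  obtain ⟨ℓ, hℓ⟩ := hP.exists_isBellmanConstant c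
  refine ⟨⟨ℓ, hℓ, hℓ.averageValue_eq c hP, hℓ.tendsto_discountedRiskValue c hP hφ⟩,
    fun f hf ε _ hopt δ hδ => ?_, fun f hf => ?_⟩
  · obtain ⟨m, hm⟩ := hP.exists_isPoissonConstant c hf hf.measurable
    obtain ⟨C, hC, hle⟩ := hm.exists_le_discountedRiskReward c hf.measurable hφ
    -- Then `C * γ ≥ (C + 1) * γ > -δ`; the `+ 1` covers `C = 0`.
    refine ⟨-(δ / (C + 1)), by simpa using div_pos hδ (by linarith), fun γ hγ hγ0 k x => ?_⟩
    -- Both average rewards are constants, so near-optimality compares the Bellman and Poisson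
    -- constants.
    have h1 : ℓ ≤ m + ε := by
      have h := hopt x
      rw [hℓ.averageValue_eq c hP, hm.averageReward_eq c hf.measurable] at h
      exact_mod_cast h
    have h2 : -δ ≤ C * γ := by
      have h := mul_le_mul_of_nonneg_left hγ.le (by linarith : 0 ≤ C + 1)
      have e : (C + 1) * -(δ / (C + 1)) = -δ := by
        have : C + 1 ≠ 0 := by linarith
        field_simp
      rw [e] at h
      linarith
    calc discountedRiskValue P c φ γ k x ≤ (ℓ : EReal) := hℓ.discountedRiskValue_le c hφ hγ0 k x
      _ ≤ ((m + C * γ : ℝ) : EReal) + ((ε + δ : ℝ) : EReal) := by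
        rw [← EReal.coe_add]
        exact EReal.coe_le_coe_iff.2 (by linarith)
      _ ≤ _ := add_le_add (hle γ hγ0 k x) le_rfl
  · obtain ⟨m, hm⟩ := hP.exists_isPoissonConstant c hf hf.measurable
    refine ⟨m, hm, hm.averageReward_eq c hf.measurable, fun k x =>
      ⟨hm.tendsto_discountedRiskReward c hf.measurable hφ k x, ?_⟩⟩
    simp_rw [ControlledProcess.riskReward_eq_discountedRiskReward]
    exact hm.tendsto_discountedRiskReward c hf.measurable isDiscountFactor_one 0 x
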